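/- Let $n\ge 1$, $p\in\{0,1,2,\dots\}\cup\{+\infty\}$, let $\mathbb T$ be the unit circle in $\mathbb C$, let $\gamma_1,\dots,\gamma_n:\mathbb T\to\mathbb C$ be maps, and put $\gamma=\gamma_1\times\cdots\times\gamma_n:\mathbb T^n\to\mathbb C^n$, $\gamma(t_1,\dots,t_n)=(\gamma_1(t_1),\dots,\gamma_n(t_n))$. A function $g$ on $\mathbb T^n$ is called $C^p$ if $\theta\mapsto g(e^{i\theta_1},\dots,e^{i\theta_n})$ is $C^p$ on $\mathbb R^n$ (for $p=0$: continuous). Let $C^p(\gamma)$ be the vector space of all functions $f:\gamma(\mathbb T^n)\to\mathbb C$ such that $f\circ\gamma$ is $C^p$ on $\mathbb T^n$, with the topology defined by the seminorms $$|f|_\alpha=\sup_{\theta\in\mathbb R^n}\left|\frac{\partial^\alpha (f\circ\gamma)}{\partial\theta^\alpha}(e^{i\theta_1},\dots,e^{i\theta_n})\right|,\qquad \alpha\in\mathbb N^n,\ |\alpha|\le p.$$ A function $f:\gamma(\mathbb T^n)\to\mathbb C$ is holomorphically extendable at $\zeta\in\gamma(\mathbb T^n)$ if there are an open neighborhood $U\subseteq\mathbb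 C^n$ of $\zeta$ and a holomorphic $F:U\to\mathbb C$ with $F=f$ on $U\cap\gamma(\mathbb T^n)$. It is real analytic at $\gamma(t)$, $t=(e^{i\theta_1},\dots,e^{i\theta_n})$ (a notion used when $\gamma$ is injective), if $s\mapsto f(\gamma(e^{is_1},\dots,e^{is_n}))$ is given near $(\theta_1,\dots,\theta_n)$ by a convergent power series in the real variables $s_1,\dots,s_n$. (1) Suppose that every $\gamma_i$ is a locally injective $C^p$ curve. Then for every $\zeta\in\gamma(\mathbb T^n)$ the set of $f\in C^p(\gamma)$ that are not holomorphically extendable at $\zeta$ is a dense $G_\delta$ subset of $C^p(\gamma)$; and the set of $f\in C^p(\gamma)$ that are holomorphically extendable at no point of $\gamma(\mathbb T^n)$ is also a dense $G_\delta$ subset of $C^p(\gamma)$. (2) Suppose that every $\gamma_i$ is an analytic Jordan curve, i.e. the restriction to $\mathbb T$ of an injective holomorphic map defined on an open neighborhood of $\mathbb T$. Then for every $t\in\mathbb T^n$ the set of $f\in C^p(\gamma)$ that are not real analytic at $\gamma(t)$ is a dense $G_\delta$ subset of $C^p(\gamma)$; and the set of $f\in C^p(\gamma)$ that are real analytic at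 no point of $\gamma(\mathbb T^n)$ is also a dense $G_\delta$ subset of $C^p(\gamma)$. -/

import Mathlib

open Set Topology

noncomputable section

namespace HolExt

/-- The map `(θ₁, …, θₙ) ↦ (e^{iθ₁}, …, e^{iθₙ})` from `ℝⁿ` onto the torus `𝕋ⁿ`. -/
def torusExp {n : ℕ} (θ : Fin n → ℝ) : Fin n → Circle := fun i => Circle.exp (θ i)

/-- A closed curve `c : 𝕋 → ℂ` is of class `C^p` if `θ ↦ c(e^{iθ})` is `C^p` on `ℝ`
(for `p = 0`: continuous; for `p = ⊤`: smooth). -/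
def IsCpCurve (p : ℕ∞) (c : Circle → ℂ) : Prop :=
  ContDiff ℝ p (fun θ : ℝ => c (Circle.exp θ))

/-- Every point of `𝕋` has a neighbourhood on which `c` is injective. -/
def IsLocallyInjectiveCurve (c : Circle → ℂ) : Prop :=
  ∀ t : Circle, ∃ V ∈ 𝓝 t, InjOn c V

/-- `c` is an analytic Jordan curve: it is the restriction to `𝕋` of an injective holomorphic map
on an open neighbourhood of `𝕋` (such a map is a biholomorphism onto an open neighbourhood
of `c(𝕋)`). -/
def IsAnalyticJordanCurve (c : Circle → ℂ) : Prop :=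
  ∃ (V : Set ℂ) (Φ : ℂ → ℂ), IsOpen V ∧ (∀ t : Circle, (t : ℂ) ∈ V) ∧
    DifferentiableOn ℂ Φ V ∧ InjOn Φ V ∧ ∀ t : Circle, c t = Φ t

/-- The product map `γ = γ₁ × ⋯ × γₙ : 𝕋ⁿ → ℂⁿ`. -/
def prodCurve {n : ℕ} (γ : Fin n → Circle → ℂ) (t : Fin n → Circle) : Fin n → ℂ :=
  fun i => γ i (t i)

/-- The image `γ(𝕋ⁿ) = γ₁(𝕋) × ⋯ × γₙ(𝕋)` in `ℂⁿ`. -/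
def torusImage {n : ℕ} (γ : Fin n → Circle → ℂ) : Set (Fin n → ℂ) := range (prodCurve γ)

/-- The composition `f ∘ γ : 𝕋ⁿ → ℂ` of a function `f : γ(𝕋ⁿ) → ℂ` with `γ`. -/
def pullback {n : ℕ} (γ : Fin n → Circle → ℂ) (f : torusImage γ → ℂ) (t : Fin n → Circle) : ℂ :=
  f ⟨prodCurve γ t, mem_range_self t⟩

/-- A function `g : 𝕋ⁿ → ℂ` is of class `C^p` if `θ ↦ g(e^{iθ₁}, …, e^{iθₙ})` is `C^p`
on `ℝⁿ`. -/
def IsCpTorus {n : ℕ} (p : ℕ∞) (g : (Fin n → Circle) → ℂ) : Prop :=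
  ContDiff ℝ p (fun θ : Fin n → ℝ => g (torusExp θ))

/-- The partial derivative `∂^k g / ∂θ_{I 0} ⋯ ∂θ_{I (k-1)}` of `g : 𝕋ⁿ → ℂ` at the point
`(e^{iθ₁}, …, e^{iθₙ})`: the `k`-th derivative of `θ ↦ g(e^{iθ₁}, …, e^{iθₙ})` evaluated at the
standard basis vectors `e_{I 0}, …, e_{I (k-1)}`. As `I` runs over all sequences of length `k`,
these are all the derivatives `∂^α g / ∂θ^α` with `|α| = k`. -/
def torusPartial {n : ℕ} (g : (Fin n → Circle) → ℂ) (k : ℕ) (I : Fin k → Fin n)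
    (θ : Fin n → ℝ) : ℂ :=
  iteratedFDeriv ℝ k (fun s : Fin n → ℝ => g (torusExp s)) θ (fun j => Pi.single (I j) 1)

/-- The functions `f : γ(𝕋ⁿ) → ℂ` such that `f ∘ γ` is `C^p` on `𝕋ⁿ`. -/
def cpSubmodule {n : ℕ} (p : ℕ∞) (γ : Fin n → Circle → ℂ) : Submodule ℂ (torusImage γ → ℂ) where
  carrier := {f | IsCpTorus p (pullback γ f)}
  add_mem' {f g} hf hg := by
    have hf' : ContDiff ℝ p (fun θ : Fin n → ℝ => pullback γ f (torusExp θ)) := hf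
    have hg' : ContDiff ℝ p (fun θ : Fin n → ℝ => pullback γ g (torusExp θ)) := hg
    exact hf'.add hg'
  zero_mem' := contDiff_const (c := (0 : ℂ)) (n := p) (𝕜 := ℝ) (E := Fin n → ℝ)
  smul_mem' c f hf := by
    have hf' : ContDiff ℝ p (fun θ : Fin n → ℝ => pullback γ f (torusExp θ)) := hf
    exact hf'.const_smul c

/-- The space `C^p(γ)`, as a vector space; it gets its own topology below. -/
def CpSpace {n : ℕ} (p : ℕ∞) (γ : Fin n → Circle → ℂ) : Type := cpSubmodule p γ

variable {n : ℕ} {p : ℕ∞} {γ : Fin n → Circle → ℂ}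

instance : AddCommGroup (CpSpace p γ) := inferInstanceAs (AddCommGroup (cpSubmodule p γ))

instance : Module ℂ (CpSpace p γ) := inferInstanceAs (Module ℂ (cpSubmodule p γ))

/-- The function `γ(𝕋ⁿ) → ℂ` underlying an element of `C^p(γ)`. -/
def CpSpace.toFun (f : CpSpace p γ) : torusImage γ → ℂ := Subtype.val (p := (· ∈ cpSubmodule p γ)) f

theorem CpSpace.isCpTorus (f : CpSpace p γ) : IsCpTorus p (pullback γ f.toFun) :=
  Subtype.property (p := (· ∈ cpSubmodule p γ)) f

theorem torusExp_fract (θ : Fin n → ℝ) :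
    ∃ a : Fin n → ℝ, θ + a ∈ Icc (0 : Fin n → ℝ) (fun _ => 2 * Real.pi) ∧
      ∀ s, torusExp (s + a) = torusExp s := by
  have h : ∀ x : ℝ, ∃ b : ℝ, x + b ∈ Icc 0 (2 * Real.pi) ∧
      ∀ y, Circle.exp (y + b) = Circle.exp y := by
    intro x
    refine ⟨-(toIcoDiv Real.two_pi_pos 0 x • (2 * Real.pi)), ?_, ?_⟩
    · have := toIcoMod_mem_Ico Real.two_pi_pos 0 x
      rw [toIcoMod, zero_add, sub_eq_add_neg] at this
      exact Ico_subset_Icc_self this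
    · intro y
      rw [← sub_eq_add_neg]
      exact Circle.periodic_exp.sub_zsmul_eq _
  choose b hb hb' using h
  exact ⟨fun i => b (θ i), ⟨fun i => (hb (θ i)).1, fun i => (hb (θ i)).2⟩,
    fun s => funext fun i => hb' (θ i) (s i)⟩

theorem bddAbove_torusPartial {g : (Fin n → Circle) → ℂ} (hg : IsCpTorus p g) {k : ℕ}
    (hk : (k : ℕ∞) ≤ p) (I : Fin k → Fin n) :
    BddAbove (range fun θ => ‖torusPartial g k I θ‖) := by
  have hc : Continuous fun θ => ‖torusPartial g k I θ‖ := by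
    have h1 := ContDiff.continuous_iteratedFDeriv (m := k) (by exact_mod_cast hk) hg
    unfold torusPartial
    fun_prop
  obtain ⟨C, hC⟩ := (isCompact_Icc (a := (0 : Fin n → ℝ))
    (b := fun _ => 2 * Real.pi)).bddAbove_image hc.continuousOn
  refine ⟨C, ?_⟩
  rintro _ ⟨θ, rfl⟩
  obtain ⟨a, ha, hper⟩ := torusExp_fract θ
  have h2 : torusPartial g k I θ = torusPartial g k I (θ + a) := by
    unfold torusPartial
    rw [← iteratedFDeriv_comp_add_right]
    simp only [hper]
  have h3 := hC (mem_image_of_mem _ ha)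
  simpa only [h2] using h3

theorem torusPartial_add {f g : (Fin n → Circle) → ℂ} (hf : IsCpTorus p f) (hg : IsCpTorus p g)
    {k : ℕ} (hk : (k : ℕ∞) ≤ p) (I : Fin k → Fin n) (θ : Fin n → ℝ) :
    torusPartial (fun t => f t + g t) k I θ = torusPartial f k I θ + torusPartial g k I θ := by
  have h : ((k : ℕ) : WithTop ℕ∞) ≤ p := by exact_mod_cast hk
  unfold torusPartial
  exact congrArg (fun m => m fun j => Pi.single (I j) 1)
    (iteratedFDeriv_add_apply (x := θ) (hf.of_le h).contDiffAt (hg.of_le h).contDiffAt)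

theorem torusPartial_smul {f : (Fin n → Circle) → ℂ} (hf : IsCpTorus p f) (c : ℂ)
    {k : ℕ} (hk : (k : ℕ∞) ≤ p) (I : Fin k → Fin n) (θ : Fin n → ℝ) :
    torusPartial (fun t => c • f t) k I θ = c • torusPartial f k I θ := by
  have h : ((k : ℕ) : WithTop ℕ∞) ≤ p := by exact_mod_cast hk
  unfold torusPartial
  rw [iteratedFDeriv_const_smul_apply' (hf.of_le h).contDiffAt]
  rfl

/-- The seminorms `sup_θ |∂^α (f ∘ γ) / ∂θ^α (e^{iθ₁}, …, e^{iθₙ})|`, `|α| ≤ p`, on `C^p(γ)`. -/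
def cpSeminorm (p : ℕ∞) (γ : Fin n → Circle → ℂ) :
    SeminormFamily ℂ (CpSpace p γ) (Σ k : {k : ℕ // (k : ℕ∞) ≤ p}, Fin k.1 → Fin n) :=
  fun ι => Seminorm.of
    (fun f => ⨆ θ : Fin n → ℝ, ‖torusPartial (pullback γ f.toFun) ι.1.1 ι.2 θ‖)
    (fun f g => by
      refine ciSup_le fun θ => ?_
      have e : torusPartial (pullback γ (f + g).toFun) ι.1.1 ι.2 θ = _ :=
        torusPartial_add f.isCpTorus g.isCpTorus ι.1.2 ι.2 θ
      rw [e]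
      exact (norm_add_le _ _).trans (add_le_add
        (le_ciSup (bddAbove_torusPartial f.isCpTorus ι.1.2 ι.2) θ)
        (le_ciSup (bddAbove_torusPartial g.isCpTorus ι.1.2 ι.2) θ)))
    (fun c f => by
      have e : ∀ θ, torusPartial (pullback γ (c • f).toFun) ι.1.1 ι.2 θ = _ :=
        torusPartial_smul f.isCpTorus c ι.1.2 ι.2
      simp only [e, norm_smul]
      exact (Real.mul_iSup_of_nonneg (norm_nonneg c) _).symm)

/-- `C^p(γ)` carries the topology defined by the seminorms `cpSeminorm`. -/
instance : TopologicalSpace (CpSpace p γ) := (cpSeminorm p γ).moduleFilterBasis.topology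

theorem withSeminorms_cpSeminorm : WithSeminorms (cpSeminorm p γ) := ⟨rfl⟩

/-- A function `f : L → ℂ`, `L ⊆ ℂⁿ`, is holomorphically extendable at `ζ`: there are an open
neighbourhood `U` of `ζ` and a holomorphic `F : U → ℂ` with `F = f` on `U ∩ L`. -/
def IsHolExtendableAt {L : Set (Fin n → ℂ)} (f : L → ℂ) (ζ : Fin n → ℂ) : Prop :=
  ∃ (U : Set (Fin n → ℂ)) (F : (Fin n → ℂ) → ℂ), IsOpen U ∧ ζ ∈ U ∧ DifferentiableOn ℂ F U ∧
    ∀ z : L, (z : Fin n → ℂ) ∈ U → F z = f z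

/-- A function `g : 𝕋ⁿ → ℂ` is real analytic at `t = (e^{iθ₁}, …, e^{iθₙ})`: near
`(θ₁, …, θₙ)` the function `s ↦ g(e^{is₁}, …, e^{isₙ})` is the sum of a convergent power series
in the real variables `s₁, …, sₙ`. -/
def IsRealAnalyticAt (g : (Fin n → Circle) → ℂ) (t : Fin n → Circle) : Prop :=
  ∃ θ : Fin n → ℝ, torusExp θ = t ∧ AnalyticAt ℝ (fun s : Fin n → ℝ => g (torusExp s)) θ

end HolExt

end

/-! Call `f` good at a point if it is holomorphically extendable (or real analytic) there, and bad
otherwise.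

Density. The functions good at a given point form a linear subspace, and badness everywhere can be
tested on a countable dense set of points, because goodness persists nearby. If one `g` is bad
everywhere, each line `f + ε g` meets each of these subspaces at most once, so all but countably
many real `ε` give a function bad everywhere (`dense_setOf_forall_notMem`). Completeness of `C^p(γ)`
plays no role.

G_δ. The functions good at a point are a countable union of classes with an explicit radius and
bound. Each class is closed even for pointwise convergence, by compactness
(`isClosed_holomorphicClass`, `isClosed_powerSeriesClass`), and point evaluations are continuous on
`C^p(γ)`.

Existence of `g`. A function of one coordinate suffices. A locally injective curve `c` has dense
complement, so poles `w k` can be chosen off `c` and dense in the plane. In the series `∑ a k * ε k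
/ (z - w k)` with coefficients in the cube `[0,1]^ℕ`, a Baire argument on the cube yields a sum with
no local extension (`exists_nowhere_extendable`). For real analyticity this is applied to the unit
circle, where analyticity in the angle gives a holomorphic extension, and the result is transported
by the inverse of `γ i`. -/

namespace HolExt

open Filter Metric

/-! ### Bounded holomorphic extensions: closedness under pointwise limits -/

section ClosednessHolomorphic

variable {E : Type*} [NormedAddCommGroup E] [NormedSpace ℂ E]

/-- The first derivative of a bounded holomorphic function at the centre of a ball is controlled. -/
theorem norm_fderiv_le_of_bounded {F : E → ℂ} {z : E} {ρ M : ℝ} (hρ : 0 < ρ)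
    (hF : DifferentiableOn ℂ F (ball z ρ)) (hM : ∀ w ∈ ball z ρ, ‖F w‖ ≤ M) :
    ‖fderiv ℂ F z‖ ≤ (M + M) / ρ := by
  refine Complex.norm_fderiv_le_div_of_mapsTo_ball hF (fun w hw => ?_) hρ
  rw [mem_closedBall, dist_eq_norm]
  exact (norm_sub_le _ _).trans (add_le_add (hM w hw) (hM z (mem_ball_self hρ)))

/-- Second order Taylor estimate for a bounded holomorphic function, with a constant depending
only on the bound and the radius. -/
theorem norm_sub_fderiv_le_of_bounded {F : E → ℂ} {z : E} {ρ M : ℝ} (hρ : 0 < ρ)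
    (hF : DifferentiableOn ℂ F (ball z ρ)) (hM : ∀ w ∈ ball z ρ, ‖F w‖ ≤ M)
    {w : E} (hw : w ∈ ball z ρ) :
    ‖F w - F z - fderiv ℂ F z (w - z)‖ ≤ (4 * M) / ρ ^ 2 * ‖w - z‖ ^ 2 := by
  set D := fderiv ℂ F z
  have hD : ‖D‖ ≤ (M + M) / ρ := norm_fderiv_le_of_bounded hρ hF hM
  have hF' : HasFDerivAt F D z :=
    ((hF z (mem_ball_self hρ)).differentiableAt (ball_mem_nhds z hρ)).hasFDerivAt
  have hG : DifferentiableOn ℂ (fun w => F w - D (w - z)) (ball z ρ) :=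
    hF.sub (D.differentiable.comp (differentiable_id.sub_const z)).differentiableOn
  -- `4 * M` is `M + M` from the two values of `F` plus `M + M` from the linear term. The remainder
  -- is `o(‖w - z‖)`, so the higher-order Schwarz lemma makes it quadratically small.
  have hmaps : MapsTo (fun w => F w - D (w - z)) (ball z ρ)
      (closedBall (F z - D (z - z)) (4 * M)) := by
    intro w hw
    have h1 : ‖D (w - z)‖ ≤ M + M := by
      refine (D.le_opNorm _).trans ?_
      have h2 : ‖w - z‖ ≤ ρ := by simpa [dist_eq_norm] using (mem_ball.1 hw).le
      calc ‖D‖ * ‖w - z‖ ≤ (M + M) / ρ * ρ := by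
            gcongr
            exact (norm_nonneg _).trans hD
        _ = M + M := by field_simp
    rw [mem_closedBall, dist_eq_norm]
    have e : F w - D (w - z) - (F z - D (z - z)) = F w - F z - D (w - z) := by simp; ring
    rw [e]
    have := norm_sub_le (F w - F z) (D (w - z))
    have := norm_sub_le (F w) (F z)
    have := hM w hw
    have := hM z (mem_ball_self hρ)
    linarith
  have ho : (fun w => F w - D (w - z) - (F z - D (z - z))) =o[𝓝 z] fun w => ‖w - z‖ ^ 1 := by
    have := hF'.isLittleO.norm_right
    refine (this.congr_left fun w => ?_).congr_right fun w => by simp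
    simp; ring
  have := Complex.dist_le_mul_div_pow_of_mapsTo_ball_of_isLittleO hG hmaps ho hw
  rw [dist_eq_norm, dist_eq_norm] at this
  have e : F w - F z - D (w - z) = F w - D (w - z) - (F z - D (z - z)) := by simp; ring
  rw [e]
  refine this.trans (le_of_eq ?_)
  rw [div_pow, div_mul_eq_mul_div, mul_div_assoc]

/-- The functions `f` on `X` for which there is a holomorphic function `F` on the ball of radius `r`
about `x`, bounded by `M`, with `F (j s) = f s` whenever `j s` lies in this ball. -/
def holomorphicClass {X : Type*} (j : X → E) (x : E) (r M : ℝ) : Set (X → ℂ) :=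
  {f | ∃ F : E → ℂ, DifferentiableOn ℂ F (ball x r) ∧
      (∀ z ∈ ball x r, ‖F z‖ ≤ M) ∧ ∀ s, j s ∈ ball x r → F (j s) = f s}

/-- A Montel argument with ultrafilters: the bounded extensions converge pointwise along `u`, and so
do their derivatives, which lie in a compact ball of the finite-dimensional dual. The uniform
quadratic Taylor estimate passes to the limit and gives differentiability. -/
theorem isClosed_holomorphicClass [FiniteDimensional ℂ E] {X : Type*}
    (j : X → E) (x : E) (r M : ℝ) : IsClosed (holomorphicClass j x r M) := by
  rw [isClosed_iff_ultrafilter]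
  intro f u huf hu
  have hu' : ∀ᶠ g in (u : Filter (X → ℂ)), ∃ F : E → ℂ, DifferentiableOn ℂ F (ball x r) ∧
      (∀ z ∈ ball x r, ‖F z‖ ≤ M) ∧ ∀ s, j s ∈ ball x r → F (j s) = g s := hu
  obtain ⟨Φ, hΦ⟩ := hu'.choice
  have hev : ∀ s, Tendsto (fun g : X → ℂ => g s) u (𝓝 (f s)) := fun s =>
    ((continuous_apply s).tendsto f).mono_left huf
  have hlim : ∀ z ∈ ball x r, ∃ y : ℂ, ‖y‖ ≤ M ∧ Tendsto (fun g => Φ g z) u (𝓝 y) := by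
    intro z hz
    have hK := (isCompact_closedBall (0 : ℂ) M).ultrafilter_le_nhds (u.map fun g => Φ g z) (by
      rw [Ultrafilter.coe_map, le_principal_iff, Filter.mem_map]
      filter_upwards [hΦ] with g hg
      simpa using hg.2.1 z hz)
    obtain ⟨y, hy, hy'⟩ := hK
    exact ⟨y, by simpa using hy, hy'⟩
  choose! G hGM hG using hlim
  refine ⟨G, ?_, hGM, ?_⟩
  · intro z hz
    obtain ⟨ρ, hρ, hρz⟩ := Metric.isOpen_iff.1 isOpen_ball z hz
    have : ProperSpace (E →L[ℂ] ℂ) := FiniteDimensional.proper ℂ _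
    have hK := (isCompact_closedBall (0 : E →L[ℂ] ℂ) ((M + M) / ρ)).ultrafilter_le_nhds
      (u.map fun g => fderiv ℂ (Φ g) z) (by
        rw [Ultrafilter.coe_map, le_principal_iff, Filter.mem_map]
        filter_upwards [hΦ] with g hg
        simpa using norm_fderiv_le_of_bounded hρ (hg.1.mono hρz) fun w hw => hg.2.1 w (hρz hw))
    obtain ⟨D, -, hD⟩ := hK
    have hD' : Tendsto (fun g => fderiv ℂ (Φ g) z) u (𝓝 D) := hD
    have key : ∀ w ∈ ball z ρ, ‖G w - G z - D (w - z)‖ ≤ (4 * M) / ρ ^ 2 * ‖w - z‖ ^ 2 := by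
      intro w hw
      have hDw : Tendsto (fun g => fderiv ℂ (Φ g) z (w - z)) u (𝓝 (D (w - z))) :=
        ((ContinuousLinearMap.apply ℂ ℂ (w - z)).continuous.tendsto D).comp hD'
      refine le_of_tendsto (((hG w (hρz hw)).sub (hG z hz)).sub hDw).norm ?_
      filter_upwards [hΦ] with g hg
      exact norm_sub_fderiv_le_of_bounded hρ (hg.1.mono hρz) (fun w hw => hg.2.1 w (hρz hw)) hw
    have hder : HasFDerivAt G D z := by
      refine .of_isLittleO ?_
      have hO : (fun w => G w - G z - D (w - z)) =O[𝓝 z] fun w => ‖w - z‖ ^ 2 := by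
        refine Asymptotics.IsBigO.of_bound ((4 * M) / ρ ^ 2) ?_
        filter_upwards [ball_mem_nhds z hρ] with w hw
        simpa using key w hw
      refine hO.trans_isLittleO ?_
      have h2 : (fun w : E => ‖w - z‖ ^ 2) =o[𝓝 z] fun w => ‖w - z‖ ^ 1 := by
        have h0 : Tendsto (fun w : E => ‖w - z‖) (𝓝 z) (𝓝 0) :=
          tendsto_norm_sub_self z
        exact (Asymptotics.isLittleO_pow_pow one_lt_two).comp_tendsto h0
      simpa using h2
    exact hder.differentiableAt.differentiableWithinAt
  · intro s hs
    refine tendsto_nhds_unique (hG _ hs) ((hev s).congr' ?_)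
    filter_upwards [hΦ] with g hg
    exact (hg.2.2 s hs).symm

/-- A function with a holomorphic extension near `x` has a bounded one on a small ball. -/
theorem exists_mem_holomorphicClass {X : Type*} {j : X → E} {x : E} {U : Set E} (hU : IsOpen U)
    (hx : x ∈ U) {F : E → ℂ} (hF : DifferentiableOn ℂ F U) {f : X → ℂ}
    (hf : ∀ s, j s ∈ U → F (j s) = f s) :
    ∃ m : ℕ, f ∈ holomorphicClass j x (1 / (m + 1)) m := by
  have hc : ContinuousAt F x := (hF x hx).continuousWithinAt.continuousAt (hU.mem_nhds hx)
  have hev : ∀ᶠ z in 𝓝 x, z ∈ U ∧ ‖F z‖ < ‖F x‖ + 1 :=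
    Filter.Eventually.and (hU.mem_nhds hx) (hc.norm.eventually_lt_const (lt_add_one _))
  obtain ⟨ε, hε, hball⟩ := Metric.eventually_nhds_iff_ball.1 hev
  obtain ⟨m, hm⟩ := exists_nat_ge (max (‖F x‖ + 1) (1 / ε))
  have hsub : ball x (1 / ((m : ℝ) + 1)) ⊆ ball x ε := by
    refine ball_subset_ball ?_
    rw [div_le_iff₀ (by positivity)]
    have := (div_le_iff₀ hε).1 ((le_max_right _ _).trans hm)
    nlinarith
  exact ⟨m, F, hF.mono fun z hz => (hball z (hsub hz)).1,
    fun z hz => (hball z (hsub hz)).2.le.trans ((le_max_left _ _).trans hm),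
    fun s hs => hf s (hball _ (hsub hs)).1⟩

end ClosednessHolomorphic

/-! ### Power series with geometric coefficient bounds: closedness under pointwise limits -/

section ClosednessAnalytic

variable {E : Type*} [NormedAddCommGroup E] [NormedSpace ℝ E]

theorem finiteDimensional_continuousMultilinearMap [FiniteDimensional ℝ E] (k : ℕ) :
    FiniteDimensional ℝ (ContinuousMultilinearMap ℝ (fun _ : Fin k => E) ℂ) :=
  FiniteDimensional.of_injective
    (ContinuousMultilinearMap.toMultilinearMapLinear :
      ContinuousMultilinearMap ℝ (fun _ : Fin k => E) ℂ →ₗ[ℝ]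
        MultilinearMap ℝ (fun _ : Fin k => E) ℂ)
    ContinuousMultilinearMap.toMultilinearMap_injective

/-- The functions given on the ball of radius `r` about `x` by a power series whose `k`-th
coefficient has norm at most `C ^ (k + 1)`. -/
def powerSeriesClass (x : E) (C r : ℝ) : Set (E → ℂ) :=
  {f | ∃ P : FormalMultilinearSeries ℝ E ℂ, (∀ k, ‖P k‖ ≤ C ^ (k + 1)) ∧
    ∀ z ∈ ball x r, ∑' k, P k (fun _ => z - x) = f z}

theorem norm_coeff_apply_le {P : FormalMultilinearSeries ℝ E ℂ} {C r : ℝ}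
    (hP : ∀ k, ‖P k‖ ≤ C ^ (k + 1)) {x z : E} (hz : z ∈ ball x r) (hC : 0 ≤ C) (k : ℕ) :
    ‖P k (fun _ => z - x)‖ ≤ C * (C * r) ^ k := by
  have hz' : ‖z - x‖ ≤ r := by simpa [dist_eq_norm] using (mem_ball.1 hz).le
  calc ‖P k (fun _ => z - x)‖ ≤ ‖P k‖ * ‖z - x‖ ^ k := by
        simpa using (P k).le_opNorm fun _ => z - x
    _ ≤ C ^ (k + 1) * r ^ k := by
        gcongr
        exact hP k
    _ = C * (C * r) ^ k := by ring

/-- The admissible coefficient sequences form a compact product of balls (Tychonoff). As `C * r <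
1`, the sum depends continuously on them, so the class is the projection of a closed set along a
compact factor. -/
theorem isClosed_powerSeriesClass [FiniteDimensional ℝ E] (x : E) {C r : ℝ} (hC : 0 ≤ C)
    (hr : 0 ≤ r) (hCr : C * r < 1) : IsClosed (powerSeriesClass x C r) := by
  have (k : ℕ) : ProperSpace (ContinuousMultilinearMap ℝ (fun _ : Fin k => E) ℂ) :=
    have := finiteDimensional_continuousMultilinearMap (E := E) k
    FiniteDimensional.proper ℝ _
  let K : Set (∀ k : ℕ, ContinuousMultilinearMap ℝ (fun _ : Fin k => E) ℂ) :=
    Set.pi univ fun k => closedBall 0 (C ^ (k + 1))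
  have hK : IsCompact K := isCompact_univ_pi fun k => isCompact_closedBall _ _
  have : CompactSpace K := isCompact_iff_compactSpace.1 hK
  have hKle (P : K) (k : ℕ) : ‖P.1 k‖ ≤ C ^ (k + 1) := by
    simpa using P.2 k (mem_univ k)
  let S : Set (K × (E → ℂ)) := {q | ∀ z ∈ ball x r, ∑' k, q.1.1 k (fun _ => z - x) = q.2 z}
  have hS : IsClosed S := by
    simp only [S, ofPred_forall]
    refine isClosed_iInter fun z => isClosed_iInter fun hz => isClosed_eq ?_ (by fun_prop)
    refine continuous_tsum (u := fun k => C * (C * r) ^ k) (fun k => ?_)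
      ((summable_geometric_of_lt_one (by positivity) hCr).mul_left C)
      (fun k q => norm_coeff_apply_le (hKle q.1) hz hC k)
    have h1 : Continuous fun q : K × (E → ℂ) => q.1.1 k :=
      (continuous_apply k).comp (continuous_subtype_val.comp continuous_fst)
    exact (ContinuousMultilinearMap.apply ℝ (fun _ : Fin k => E) ℂ
      fun _ => z - x).continuous.comp h1
  have himg : powerSeriesClass x C r = Prod.snd '' S := by
    ext f
    constructor
    · rintro ⟨P, hP, hf⟩
      exact ⟨(⟨P, fun k _ => by simpa using hP k⟩, f), hf, rfl⟩
    · rintro ⟨⟨P, g⟩, hq, rfl⟩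
      exact ⟨P.1, hKle P, hq⟩
  rw [himg]
  exact isClosedMap_snd_of_compactSpace _ hS

/-- One index controls both data: the coefficient bound grows while the radius shrinks, with product
always `1 / 2`. -/
theorem analyticAt_iff_exists_mem_powerSeriesClass {f : E → ℂ} {x : E} :
    AnalyticAt ℝ f x ↔ ∃ m : ℕ, f ∈ powerSeriesClass x (m + 1) (1 / (2 * (m + 1))) := by
  constructor
  · rintro ⟨P, R, hP⟩
    obtain ⟨ρ, hρ0, hρR⟩ := ENNReal.lt_iff_exists_nnreal_btwn.1 hP.r_pos
    obtain ⟨A, hA, hPA⟩ := P.norm_mul_pow_le_of_lt_radius (hρR.trans_le hP.r_le)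
    have hρ : (0 : ℝ) < ρ := by exact_mod_cast hρ0
    obtain ⟨m, hm⟩ := exists_nat_ge (max A (1 / (ρ : ℝ)))
    have hmA : A ≤ m + 1 := (le_max_left _ _).trans (hm.trans (by linarith))
    have hmρ : 1 / (ρ : ℝ) ≤ m + 1 := (le_max_right _ _).trans (hm.trans (by linarith))
    refine ⟨m, P, fun k => ?_, fun z hz => ?_⟩
    · calc ‖P k‖ = ‖P k‖ * (ρ : ℝ) ^ k * (1 / (ρ : ℝ)) ^ k := by
            rw [mul_assoc, ← mul_pow]; field_simp; simp
        _ ≤ (m + 1) * (m + 1) ^ k := by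
            gcongr
            exact (hPA k).trans hmA
        _ = _ := by ring
    · have hz' : z ∈ Metric.eball x R := by
        have h1 : dist z x < ρ := by
          refine (mem_ball.1 hz).trans_le ?_
          rw [div_le_iff₀ (by positivity)]
          rw [div_le_iff₀ hρ] at hmρ
          nlinarith
        have h2 : edist z x < ρ := by
          rw [edist_dist]
          exact ENNReal.ofReal_lt_coe_iff dist_nonneg |>.2 h1
        exact h2.trans hρR
      exact (hP.hasSum_sub hz').tsum_eq
  · rintro ⟨m, P, hP, hf⟩
    have hm : (0 : ℝ) < m + 1 := by positivity
    have hr : (0 : ℝ) < 1 / (2 * (m + 1)) := by positivity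
    refine HasFPowerSeriesOnBall.analyticAt (p := P) (r := ENNReal.ofReal (1 / (2 * (m + 1)))) ?_
    have hCr : ((m : ℝ) + 1) * (1 / (2 * (m + 1))) = 1 / 2 := by field_simp
    refine ⟨?_, by simpa using hr, fun {y} hy => ?_⟩
    · refine P.le_radius_of_bound (m + 1 : ℝ) (r := (1 / (2 * (m + 1)) : ℝ).toNNReal) fun k => ?_
      rw [Real.coe_toNNReal _ hr.le]
      calc ‖P k‖ * (1 / (2 * ((m : ℝ) + 1))) ^ k
          ≤ ((m : ℝ) + 1) ^ (k + 1) * (1 / (2 * (m + 1))) ^ k := by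
            gcongr
            exact hP k
        _ = (m + 1) * (1 / 2) ^ k := by rw [pow_succ', mul_assoc, ← mul_pow, hCr]
        _ ≤ (m + 1) * 1 := by
            gcongr
            exact pow_le_one₀ (by norm_num) (by norm_num)
        _ = _ := mul_one _
    · have hy' : x + y ∈ ball x (1 / (2 * ((m : ℝ) + 1))) := by
        rw [Metric.eball_ofReal] at hy
        simpa using hy
      have hs : Summable fun k => P k (fun _ => x + y - x) := by
        refine Summable.of_norm_bounded (g := fun k => ((m : ℝ) + 1) * ((m + 1) * (1 / (2 * (m + 1)))) ^ k)
          ((summable_geometric_of_lt_one (by positivity) (by rw [hCr]; norm_num)).mul_left _)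
          (fun k => norm_coeff_apply_le hP hy' hm.le k)
      have := hs.hasSum
      rw [hf _ hy'] at this
      simpa using this

end ClosednessAnalytic

/-! ### Topology of plane curves -/

section PlaneCurves

/-- An arc in the plane has empty interior. -/
theorem interior_arc_eq_empty {φ : ℝ → ℂ} {a b : ℝ} (hφ : ContinuousOn φ (Icc a b))
    (hinj : InjOn φ (Icc a b)) : interior (φ '' Icc a b) = ∅ := by
  by_contra hne
  obtain ⟨z, hz⟩ := nonempty_iff_ne_empty.2 hne
  obtain ⟨r, hr, hball⟩ := Metric.isOpen_iff.1 isOpen_interior z hz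
  -- An interior point would put a whole circle inside the arc. Inverting the parametrization then
  -- gives a continuous injection `ψ` of a circle into `ℝ`.
  have hsub : sphere z (r / 2) ⊆ φ '' Icc a b :=
    (sphere_subset_closedBall.trans (closedBall_subset_ball (half_lt_self hr))).trans
      (hball.trans interior_subset)
  have hcont : Continuous (fun x : Icc a b => φ x) := continuousOn_iff_continuous_domRestrict.1 hφ
  have hemb : IsClosedEmbedding (fun x : Icc a b => φ x) :=
    hcont.isClosedEmbedding fun x y h => Subtype.ext (hinj x.2 y.2 h)
  let e := hemb.isEmbedding.toHomeomorph
  have hmem (w : sphere (0 : ℂ) (r / 2)) : z + w ∈ range fun x : Icc a b => φ x := by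
    obtain ⟨x, hx, hxw⟩ := hsub (show z + w ∈ sphere z (r / 2) by simp)
    exact ⟨⟨x, hx⟩, hxw⟩
  let ψ : sphere (0 : ℂ) (r / 2) → ℝ := fun w => e.symm ⟨z + w, hmem w⟩
  have hψ : Continuous ψ := by
    refine continuous_subtype_val.comp (e.symm.continuous.comp ?_)
    fun_prop
  have hψinj : Function.Injective ψ := by
    intro w w' h
    have := e.symm.injective (Subtype.ext h)
    simpa [Subtype.ext_iff] using this
  have : PreconnectedSpace (sphere (0 : ℂ) (r / 2)) :=
    Subtype.preconnectedSpace (isPreconnected_sphere (by simp) _ _)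
  let w₀ : sphere (0 : ℂ) (r / 2) := ⟨(r / 2 : ℝ), by simp [abs_of_pos hr]⟩
  have hneg : Continuous fun w : sphere (0 : ℂ) (r / 2) => ψ (-w) := hψ.comp continuous_neg
  -- One-dimensional Borsuk–Ulam: this odd function on a connected circle must vanish, against
  -- injectivity.
  obtain ⟨w, hw⟩ : ∃ w, ψ w - ψ (-w) = 0 := by
    have hg : Continuous fun w => ψ w - ψ (-w) := hψ.sub hneg
    rcases le_total 0 (ψ w₀ - ψ (-w₀)) with h | h
    · exact mem_range_of_exists_le_of_exists_ge hg
        ⟨-w₀, by rw [neg_neg]; linarith⟩ ⟨w₀, h⟩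
    · exact mem_range_of_exists_le_of_exists_ge hg
        ⟨w₀, h⟩ ⟨-w₀, by rw [neg_neg]; linarith⟩
  have hww : w = -w := hψinj (sub_eq_zero.1 hw)
  have h0 : (w : ℂ) = 0 := by
    have : (w : ℂ) = -(w : ℂ) := congrArg Subtype.val hww
    exact self_eq_neg.1 this
  have := w.2
  rw [mem_sphere, h0, dist_self] at this
  linarith

/-- The complement of a locally injective closed curve is dense in the plane. -/
theorem dense_compl_range_of_isLocallyInjectiveCurve {c : Circle → ℂ} (hc : Continuous c)
    (hinj : IsLocallyInjectiveCurve c) : Dense (range c)ᶜ := by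
  -- Countably many injective arcs with rational endpoints cover the curve; each is closed with
  -- empty interior, so Baire applies.
  let J : Set (ℚ × ℚ) := {q | InjOn (fun θ : ℝ => c (Circle.exp θ)) (Icc (q.1 : ℝ) q.2)}
  have hcexp : Continuous fun θ : ℝ => c (Circle.exp θ) := hc.comp Circle.exp.continuous
  have hsub : (⋂ q ∈ J, ((fun θ : ℝ => c (Circle.exp θ)) '' Icc (q.1 : ℝ) q.2)ᶜ) ⊆
      (range c)ᶜ := by
    rintro z hz ⟨t, rfl⟩
    obtain ⟨θ, rfl⟩ : ∃ θ, Circle.exp θ = t := Circle.exp_surjective t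
    obtain ⟨V, hV, hVinj⟩ := hinj (Circle.exp θ)
    obtain ⟨δ, hδ, hδV⟩ := Metric.mem_nhds_iff.1 (Circle.exp.continuous.continuousAt.preimage_mem_nhds hV)
    -- The bound by `π` keeps the parameter interval shorter than a period, so `Circle.exp` is
    -- injective on it.
    obtain ⟨ε, hε, hεδ⟩ : ∃ ε > 0, ε ≤ δ ∧ ε ≤ Real.pi :=
      ⟨min δ Real.pi, lt_min hδ Real.pi_pos, min_le_left _ _, min_le_right _ _⟩
    obtain ⟨q₁, h1, h1'⟩ := exists_rat_btwn (show θ - ε < θ by linarith)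
    obtain ⟨q₂, h2, h2'⟩ := exists_rat_btwn (show θ < θ + ε by linarith)
    have hq : (q₁, q₂) ∈ J := by
      intro s hs s' hs' h
      have hmem : ∀ u ∈ Icc (q₁ : ℝ) q₂, Circle.exp u ∈ V := by
        intro u hu
        refine hδV ?_
        rw [mem_ball, Real.dist_eq, abs_lt]
        constructor <;> linarith [hu.1, hu.2]
      have he : Circle.exp s = Circle.exp s' := hVinj (hmem s hs) (hmem s' hs') h
      obtain ⟨m, hm⟩ := Circle.exp_eq_exp.1 he
      have hsm : |s - s'| < 2 * Real.pi := by
        rw [abs_lt]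
        simp only [mem_Icc] at hs hs'
        constructor <;> linarith
      have hm0 : m = 0 := by
        by_contra hm0
        have : (1 : ℝ) ≤ |(m : ℝ)| := by exact_mod_cast Int.one_le_abs hm0
        rw [hm, add_sub_cancel_left, abs_mul, abs_of_pos Real.two_pi_pos] at hsm
        nlinarith [Real.two_pi_pos]
      simpa [hm0] using hm
    exact (mem_iInter₂.1 hz _ hq) ⟨θ, ⟨h1'.le, h2.le⟩, rfl⟩
  refine Dense.mono hsub (dense_biInter_of_isOpen (fun q _ => ?_) (Set.to_countable J) fun q hq => ?_)
  · exact (isCompact_Icc.image hcexp).isClosed.isOpen_compl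
  · exact interior_eq_empty_iff_dense_compl.1 (interior_arc_eq_empty hcexp.continuousOn hq)

theorem continuous_of_isCpCurve {p : ℕ∞} {c : Circle → ℂ} (hc : IsCpCurve p c) : Continuous c := by
  have h : Continuous fun θ : ℝ => c (Circle.exp θ) := hc.continuous
  exact (isLocalHomeomorph_circleExp.isOpenMap.isQuotientMap Circle.exp.continuous
    Circle.exp_surjective).continuous_iff.2 h

/-- Every point of a locally injective closed curve is an accumulation point of the curve. -/
theorem frequently_mem_range_of_isLocallyInjectiveCurve {c : Circle → ℂ} (hc : Continuous c)
    (hinj : IsLocallyInjectiveCurve c) (t : Circle) : ∃ᶠ z in 𝓝[≠] (c t), z ∈ range c := by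
  obtain ⟨V, hV, hVinj⟩ := hinj t
  have : Nontrivial Circle := ⟨Circle.exp Real.pi, 1, fun h => by
    have := congrArg (fun z : Circle => (z : ℂ)) h
    norm_num [Circle.coe_exp] at this⟩
  have h1 : Tendsto c (𝓝[≠] t) (𝓝[≠] (c t)) := by
    refine tendsto_nhdsWithin_iff.2 ⟨hc.continuousAt.mono_left nhdsWithin_le_nhds, ?_⟩
    filter_upwards [mem_nhdsWithin_of_mem_nhds hV, self_mem_nhdsWithin] with s hs hst h
    exact hst (hVinj hs (mem_of_mem_nhds hV) h)
  exact h1.frequently (Frequently.of_forall fun s => mem_range_self s)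

end PlaneCurves

/-! ### A nowhere extendable function on one curve -/

section NowhereExtendable

theorem exists_bound_iteratedFDeriv_curve {p : ℕ∞} {u : Circle → ℂ} (hu : IsCpCurve p u) {j : ℕ}
    (hj : (j : ℕ∞) ≤ p) :
    ∃ B, ∀ θ, ‖iteratedFDeriv ℝ j (fun θ : ℝ => u (Circle.exp θ)) θ‖ ≤ B := by
  have hcont : Continuous fun θ => ‖iteratedFDeriv ℝ j (fun θ : ℝ => u (Circle.exp θ)) θ‖ :=
    (ContDiff.continuous_iteratedFDeriv (by exact_mod_cast hj) hu).norm
  have hper : Function.Periodic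
      (fun θ => ‖iteratedFDeriv ℝ j (fun θ : ℝ => u (Circle.exp θ)) θ‖) (2 * Real.pi) := by
    intro θ
    simp only
    rw [← iteratedFDeriv_comp_add_right]
    simp only [Circle.periodic_exp _]
  obtain ⟨B, hB⟩ := (hper.compact_of_continuous Real.two_pi_pos.ne' hcont).bddAbove
  exact ⟨B, fun θ => hB (mem_range_self θ)⟩

/-- Any sequence of `C^p` functions on the circle can be rescaled so that all its combinations with
coefficients in `[0, 1]` converge to `C^p` functions. -/
theorem exists_weights {p : ℕ∞} {u : ℕ → Circle → ℂ} (hu : ∀ k, IsCpCurve p (u k)) :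
    ∃ ε : ℕ → ℝ, (∀ k, 0 < ε k) ∧ (∀ k t, ‖(ε k : ℂ) * u k t‖ ≤ (1 / 2) ^ k) ∧
      ∀ a : ℕ → unitInterval, IsCpCurve p fun t => ∑' k, (a k : ℂ) * ((ε k : ℂ) * u k t) := by
  have hB : ∀ k j : ℕ, ∃ B : ℝ, 0 ≤ B ∧ ((j : ℕ∞) ≤ p →
      ∀ θ, ‖iteratedFDeriv ℝ j (fun θ : ℝ => u k (Circle.exp θ)) θ‖ ≤ B) := by
    intro k j
    by_cases hj : (j : ℕ∞) ≤ p
    · obtain ⟨B, hB⟩ := exists_bound_iteratedFDeriv_curve (hu k) hj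
      exact ⟨B, (norm_nonneg _).trans (hB 0), fun _ => hB⟩
    · exact ⟨0, le_rfl, fun h => absurd h hj⟩
  choose B hB0 hB using hB
  -- `S k` dominates the bounds for all orders `j ≤ k` at once, orders above `p` contributing the
  -- dummy bound `0`. For fixed `j` the terms with `k ≥ j` are thus geometrically small, so one
  -- weight sequence serves even `p = ⊤`.
  set S : ℕ → ℝ := fun k => 1 + ∑ j ∈ Finset.range (k + 1), B k j with hSdef
  have hS : ∀ k, 0 < S k := fun k =>
    add_pos_of_pos_of_nonneg one_pos (Finset.sum_nonneg fun j _ => hB0 k j)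
  have hBS : ∀ k j, j ≤ k → B k j ≤ S k := by
    intro k j hjk
    have := Finset.single_le_sum (f := B k) (fun i _ => hB0 k i)
      (Finset.mem_range.2 (Nat.lt_succ_of_le hjk))
    simp only [hSdef]
    linarith
  have hε : ∀ k, 0 < (1 / 2 : ℝ) ^ k / S k := fun k => div_pos (by positivity) (hS k)
  have hmul : ∀ k j, j ≤ k → (1 / 2 : ℝ) ^ k / S k * B k j ≤ (1 / 2) ^ k := by
    intro k j hjk
    rw [div_mul_eq_mul_div, div_le_iff₀ (hS k)]
    exact mul_le_mul_of_nonneg_left (hBS k j hjk) (by positivity)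
  refine ⟨fun k => (1 / 2) ^ k / S k, hε, fun k t => ?_, fun a => ?_⟩
  · obtain ⟨θ, rfl⟩ := Circle.exp_surjective t
    have h0 := hB k 0 (by simp) θ
    rw [norm_iteratedFDeriv_zero] at h0
    rw [norm_mul, Complex.norm_real, Real.norm_of_nonneg (hε k).le]
    exact (mul_le_mul_of_nonneg_left h0 (hε k).le).trans (hmul k 0 (Nat.zero_le k))
  · have hsm : ∀ k, (fun θ : ℝ => (a k : ℂ) * ((((1 / 2) ^ k / S k : ℝ) : ℂ) *
        u k (Circle.exp θ))) = fun θ : ℝ => ((a k : ℝ) * ((1 / 2) ^ k / S k)) •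
          u k (Circle.exp θ) := by
      intro k
      ext θ
      rw [Complex.real_smul, Complex.ofReal_mul, mul_assoc]
    refine contDiff_tsum_of_eventually (v := fun _ k => (1 / 2 : ℝ) ^ k) (fun k => ?_)
      (fun j _ => summable_geometric_two) (fun j hj => ?_)
    · rw [hsm]
      exact (hu k).const_smul _
    · rw [Nat.cofinite_eq_atTop]
      filter_upwards [eventually_ge_atTop j] with k hk θ
      have hj' : (j : ℕ∞) ≤ p := by exact_mod_cast hj
      have hcd : ContDiff ℝ j fun θ : ℝ => u k (Circle.exp θ) :=
        (hu k).of_le (by exact_mod_cast hj)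
      rw [hsm, iteratedFDeriv_const_smul_apply' hcd.contDiffAt, norm_smul, norm_mul,
        Real.norm_of_nonneg (hε k).le, Real.norm_of_nonneg (a k).2.1]
      calc (a k : ℝ) * ((1 / 2) ^ k / S k) * _
          ≤ 1 * ((1 / 2) ^ k / S k) * B k j := by
            have := (hε k).le
            gcongr
            · exact (a k).2.2
            · exact hB k j hj' θ
        _ ≤ _ := by rw [one_mul]; exact hmul k j hk

/-- Two functions which differ on the curve by a multiple of `1 / (z - w)`, with the pole `w` in the
ball, cannot both have holomorphic extensions to the ball. -/
theorem eq_zero_of_mem_holomorphicClass_of_sub_eq_pole {c : Circle → ℂ} {ζ w δ : ℂ} {r M : ℝ}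
    (hζ : ∃ᶠ z in 𝓝[≠] ζ, z ∈ range c) (hw : w ∈ ball ζ r) (hwc : w ∉ range c)
    {f g : Circle → ℂ} (hf : f ∈ holomorphicClass c ζ r M) (hg : g ∈ holomorphicClass c ζ r M)
    (hfg : ∀ t, f t - g t = δ * (c t - w)⁻¹) : δ = 0 := by
  obtain ⟨F, hF, -, hFf⟩ := hf
  obtain ⟨G, hG, -, hGg⟩ := hg
  have hr : 0 < r := dist_nonneg.trans_lt hw
  -- This function vanishes on the curve near `ζ`, hence on the whole ball by the identity theorem;
  -- its value at `w` is `-δ`.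
  have hd : DifferentiableOn ℂ (fun z => (F z - G z) * (z - w) - δ) (ball ζ r) :=
    ((hF.sub hG).mul (differentiableOn_id.sub_const w)).sub_const δ
  have hfreq : ∃ᶠ z in 𝓝[≠] ζ, (F z - G z) * (z - w) - δ = 0 := by
    refine (hζ.and_eventually
      (mem_nhdsWithin_of_mem_nhds (ball_mem_nhds ζ hr))).mono ?_
    rintro _ ⟨⟨t, rfl⟩, ht⟩
    have hne : c t - w ≠ 0 := sub_ne_zero.2 fun h => hwc ⟨t, h⟩
    rw [hFf t ht, hGg t ht, hfg t, mul_assoc, inv_mul_cancel₀ hne, mul_one, sub_self]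
  have := (hd.analyticOnNhd isOpen_ball).eqOn_zero_of_preconnected_of_frequently_eq_zero
    (convex_ball ζ r).isPreconnected (mem_ball_self hr) hfreq hw
  simpa using this

/-- On a locally injective closed `C^p` curve there is a `C^p` function which is nowhere
holomorphically extendable. -/
theorem exists_nowhere_extendable {p : ℕ∞} {c : Circle → ℂ} (hc : IsCpCurve p c)
    (hinj : IsLocallyInjectiveCurve c) :
    ∃ g : ℂ → ℂ, IsCpCurve p (fun t => g (c t)) ∧ ∀ (t : Circle) (U : Set ℂ) (F : ℂ → ℂ),
      IsOpen U → c t ∈ U → DifferentiableOn ℂ F U → ¬ ∀ s, c s ∈ U → F (c s) = g (c s) := by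
  have hcc : Continuous c := continuous_of_isCpCurve hc
  have hdense : Dense (range c)ᶜ := dense_compl_range_of_isLocallyInjectiveCurve hcc hinj
  have : Nonempty ↥(range c)ᶜ := hdense.nonempty.to_subtype
  let w : ℕ → ℂ := fun k => TopologicalSpace.denseSeq ↥(range c)ᶜ k
  have hwc : ∀ k, w k ∉ range c := fun k => (TopologicalSpace.denseSeq ↥(range c)ᶜ k).2
  have hwd : DenseRange w :=
    hdense.denseRange_val.comp (TopologicalSpace.denseRange_denseSeq _) continuous_subtype_val
  have hne : ∀ k t, c t - w k ≠ 0 := fun k t => sub_ne_zero.2 fun h => hwc k ⟨t, h⟩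
  obtain ⟨ε, hε, hbound, hsmooth⟩ := exists_weights (p := p) (u := fun k t => (c t - w k)⁻¹)
    fun k => ContDiff.inv (hc.sub contDiff_const) fun θ => hne k _
  let T : (ℕ → unitInterval) → Circle → ℂ :=
    fun a t => ∑' k, (a k : ℂ) * ((ε k : ℂ) * (c t - w k)⁻¹)
  have hterm : ∀ (a : ℕ → unitInterval) k t,
      ‖(a k : ℂ) * ((ε k : ℂ) * (c t - w k)⁻¹)‖ ≤ (1 / 2) ^ k := by
    intro a k t
    rw [norm_mul, Complex.norm_real, Real.norm_of_nonneg (a k).2.1]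
    exact (mul_le_of_le_one_left (norm_nonneg _) (a k).2.2).trans (hbound k t)
  have hsum : ∀ (a : ℕ → unitInterval) t, Summable fun k => (a k : ℂ) * ((ε k : ℂ) * (c t - w k)⁻¹) :=
    fun a t => Summable.of_norm_bounded summable_geometric_two fun k => hterm a k t
  have hT : Continuous T := by
    refine continuous_pi fun t => continuous_tsum (fun k => ?_) summable_geometric_two
      fun k a => hterm a k t
    fun_prop
  let d : ℕ → Circle := TopologicalSpace.denseSeq Circle
  -- Coefficient sequences whose sum has no extension of size `q.2` near the point `c (d q.1)`;
  -- Baire is applied to these sets in the compact cube.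
  let A : ℕ × ℕ → Set (ℕ → unitInterval) := fun q =>
    (T ⁻¹' holomorphicClass c (c (d q.1)) (1 / (q.2 + 1)) q.2)ᶜ
  have hopen : ∀ q, IsOpen (A q) := fun q =>
    ((isClosed_holomorphicClass _ _ _ _).preimage hT).isOpen_compl
  have hAd : ∀ q, Dense (A q) := by
    rintro ⟨i, m⟩
    refine interior_eq_empty_iff_dense_compl.1 (eq_empty_iff_forall_notMem.2 fun a ha => ?_)
    -- Near an interior point of the complement, the coefficient of a pole inside the ball can be
    -- changed alone. Two members of the same class then differ by a nonzero multiple of that pole.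
    obtain ⟨k, hk⟩ := hwd.exists_mem_open (isOpen_ball (x := c (d i)) (ε := 1 / ((m : ℝ) + 1)))
      ⟨c (d i), mem_ball_self (by positivity)⟩
    have hupd : Continuous fun b : unitInterval => Function.update a k b :=
      continuous_const.update k continuous_id
    have hmem : (fun b : unitInterval => Function.update a k b) ⁻¹'
        interior (T ⁻¹' holomorphicClass c (c (d i)) (1 / ((m : ℝ) + 1)) m) ∈ 𝓝 (a k) :=
      (isOpen_interior.preimage hupd).mem_nhds (by simpa using ha)
    obtain ⟨b, hb, hba⟩ := (Filter.nonempty_of_mem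
      (inter_mem (mem_nhdsWithin_of_mem_nhds hmem)
        (self_mem_nhdsWithin (a := a k) (s := {a k}ᶜ))))
    have hdiff : ∀ t, T (Function.update a k b) t - T a t =
        (((b : ℂ) - a k) * ε k) * (c t - w k)⁻¹ := by
      intro t
      rw [← (hsum _ t).tsum_sub (hsum a t), tsum_eq_single k]
      · simp only [Function.update_self]
        ring
      · intro l hl
        simp [Function.update_of_ne hl]
    have h0 := eq_zero_of_mem_holomorphicClass_of_sub_eq_pole
      (frequently_mem_range_of_isLocallyInjectiveCurve hcc hinj (d i)) hk (hwc k)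
      (mem_preimage.1 (interior_subset hb)) (mem_preimage.1 (interior_subset ha)) hdiff
    rcases mul_eq_zero.1 h0 with h | h
    · exact hba (Subtype.ext (by exact_mod_cast sub_eq_zero.1 h))
    · exact (hε k).ne' (by exact_mod_cast h)
  obtain ⟨a, ha⟩ := (dense_iInter_of_isOpen hopen hAd).nonempty
  refine ⟨fun z => ∑' k, (a k : ℂ) * ((ε k : ℂ) * (z - w k)⁻¹), hsmooth a, ?_⟩
  intro t U F hU htU hF hFg
  obtain ⟨i, hi⟩ := (TopologicalSpace.denseRange_denseSeq Circle).exists_mem_open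
    (hU.preimage hcc) ⟨t, htU⟩
  obtain ⟨m, hm⟩ := exists_mem_holomorphicClass (f := T a) hU hi hF hFg
  exact mem_iInter.1 ha (i, m) hm

end NowhereExtendable

/-! ### A nowhere real analytic function on the circle -/

section NowhereAnalytic

/-- A real analytic function of one real variable extends to a holomorphic function. -/
theorem exists_analyticAt_complex_extension {φ : ℝ → ℂ} {x : ℝ} (hφ : AnalyticAt ℝ φ x) :
    ∃ G : ℂ → ℂ, AnalyticAt ℂ G x ∧ ∀ᶠ s : ℝ in 𝓝 x, G s = φ s := by
  obtain ⟨P, hP⟩ := hφ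
  -- The same scalar coefficients read as a complex power series, with the same norms.
  let Q : FormalMultilinearSeries ℂ ℂ ℂ := fun k =>
    ContinuousMultilinearMap.mkPiRing ℂ (Fin k) (P.coeff k)
  have hQ : 0 < Q.radius := by
    obtain ⟨ρ, hρ0, hρR⟩ := ENNReal.lt_iff_exists_nnreal_btwn.1 hP.radius_pos
    obtain ⟨A, hA, hPA⟩ := P.norm_mul_pow_le_of_lt_radius hρR
    refine hρ0.trans_le (Q.le_radius_of_bound A fun k => ?_)
    have : ‖Q k‖ = ‖P k‖ := by
      rw [P.norm_apply_eq_norm_coef]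
      simp [Q]
    rw [this]
    exact hPA k
  refine ⟨fun z => Q.sum (z - x), ?_, ?_⟩
  · have h1 : AnalyticAt ℂ Q.sum ((x : ℂ) - x) := by
      rw [sub_self]
      exact (Q.hasFPowerSeriesOnBall hQ).analyticAt
    exact AnalyticAt.fun_comp (f := fun z : ℂ => z - x) h1 (analyticAt_id.sub analyticAt_const)
  · have h := hasFPowerSeriesAt_iff.1 hP
    have ht : Tendsto (fun s : ℝ => s - x) (𝓝 x) (𝓝 0) := by
      simpa using (continuous_id.sub continuous_const).tendsto (f := fun s : ℝ => s - x) x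
    filter_upwards [ht.eventually h] with s hs
    rw [add_sub_cancel] at hs
    rw [← hs.tsum_eq, FormalMultilinearSeries.sum]
    refine tsum_congr fun k => ?_
    simp [Q]

/-- A function on the circle which is real analytic in the angle is the restriction of a holomorphic
function. -/
theorem exists_holomorphic_extension_of_analyticAt_circle {h : Circle → ℂ} {θ : ℝ}
    (hh : AnalyticAt ℝ (fun s : ℝ => h (Circle.exp s)) θ) :
    ∃ (U : Set ℂ) (F : ℂ → ℂ), IsOpen U ∧ (Circle.exp θ : ℂ) ∈ U ∧ DifferentiableOn ℂ F U ∧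
      ∀ s : Circle, (s : ℂ) ∈ U → F s = h s := by
  obtain ⟨G, hG, hGh⟩ := exists_analyticAt_complex_extension hh
  obtain ⟨z₀, hz₀⟩ : ∃ z : ℂ, z = (Circle.exp θ : Circle) := ⟨_, rfl⟩
  rw [← hz₀]
  have hz₀ne : z₀ ≠ 0 := hz₀ ▸ Circle.coe_ne_zero _
  -- A holomorphic local inverse of `s ↦ e^{is}` with `Λ z₀ = θ`; dividing by `z₀` keeps the
  -- logarithm away from its cut. On the circle it is the real angle `θ + arg (z / z₀)`.
  let Λ : ℂ → ℂ := fun z => θ + Complex.log (z / z₀) / Complex.I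
  have hΛ0 : Λ z₀ = θ := by simp [Λ, hz₀ne]
  have hΛ : AnalyticAt ℂ Λ z₀ := by
    refine analyticAt_const.add (AnalyticAt.div_const ?_)
    refine AnalyticAt.clog (analyticAt_id.div_const) ?_
    simp [hz₀ne]
  have hF : AnalyticAt ℂ (fun z => G (Λ z)) z₀ := AnalyticAt.fun_comp (by rwa [hΛ0]) hΛ
  have harg : ContinuousAt (fun z : ℂ => θ + Complex.arg (z / z₀)) z₀ := by
    refine continuousAt_const.add (ContinuousAt.comp' ?_ (continuousAt_id.div_const _))
    exact Complex.continuousAt_arg (by simp [hz₀ne])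
  have harg0 : θ + Complex.arg (z₀ / z₀) = θ := by simp [hz₀ne]
  have hev : ∀ᶠ z : ℂ in 𝓝 z₀, AnalyticAt ℂ (fun z => G (Λ z)) z ∧
      G ((θ + Complex.arg (z / z₀) : ℝ) : ℂ) = h (Circle.exp (θ + Complex.arg (z / z₀))) := by
    refine hF.eventually_analyticAt.and ?_
    have ht : Tendsto (fun z : ℂ => θ + Complex.arg (z / z₀)) (𝓝 z₀) (𝓝 θ) := by
      simpa only [harg0] using harg.tendsto
    exact ht.eventually hGh
  obtain ⟨U, hU, hUo, hzU⟩ := _root_.eventually_nhds_iff.1 hev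
  refine ⟨U, fun z => G (Λ z), hUo, hzU,
    fun z hz => (hU z hz).1.differentiableAt.differentiableWithinAt, fun s hs => ?_⟩
  have hquot : ((s / Circle.exp θ : Circle) : ℂ) = s / z₀ := by simp [hz₀]
  have hexp : Circle.exp (θ + Complex.arg ((s : ℂ) / z₀)) = s := by
    rw [← hquot, Circle.exp_add, Circle.exp_arg, mul_div_cancel]
  have hΛs : Λ s = ((θ + Complex.arg ((s : ℂ) / z₀) : ℝ) : ℂ) := by
    have hn : ‖(s : ℂ) / z₀‖ = 1 := by rw [← hquot]; exact Circle.norm_coe _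
    simp only [Λ, Complex.log, hn, Real.log_one]
    push_cast
    rw [zero_add, mul_div_cancel_right₀ _ Complex.I_ne_zero]
  have := (hU s hs).2
  rw [hexp] at this
  simp only [hΛs, this]

/-- There is a `C^p` function on the circle which is nowhere real analytic in the angle. -/
theorem exists_nowhere_analytic (p : ℕ∞) :
    ∃ h : Circle → ℂ, IsCpCurve p h ∧
      ∀ θ : ℝ, ¬ AnalyticAt ℝ (fun s : ℝ => h (Circle.exp s)) θ := by
  have hc : IsCpCurve p (fun t : Circle => (t : ℂ)) := by
    have : (fun θ : ℝ => ((Circle.exp θ : Circle) : ℂ)) = fun θ : ℝ => Complex.exp (θ * Complex.I) :=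
      funext fun θ => Circle.coe_exp θ
    unfold IsCpCurve
    rw [this]
    exact Complex.contDiff_exp.comp (Complex.ofRealCLM.contDiff.mul contDiff_const)
  obtain ⟨g, hg, hgne⟩ := exists_nowhere_extendable hc fun t =>
    ⟨univ, univ_mem, Subtype.val_injective.injOn⟩
  refine ⟨fun t => g t, hg, fun θ hθ => ?_⟩
  obtain ⟨U, F, hU, hmem, hF, hFg⟩ := exists_holomorphic_extension_of_analyticAt_circle (h := fun t : Circle => g t) hθ
  exact hgne _ U F hU hmem hF hFg

end NowhereAnalytic

/-! ### Point evaluations and the density principle in `C^p(γ)` -/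

section CpSpaceTopology

variable {n : ℕ} {p : ℕ∞} {γ : Fin n → Circle → ℂ}

instance : IsTopologicalAddGroup (CpSpace p γ) :=
  (withSeminorms_cpSeminorm (p := p) (γ := γ)).topologicalAddGroup

instance : ContinuousSMul ℂ (CpSpace p γ) :=
  (withSeminorms_cpSeminorm (p := p) (γ := γ)).continuousSMul

theorem torusExp_surjective (t : Fin n → Circle) : ∃ θ : Fin n → ℝ, torusExp θ = t :=
  ⟨fun i => Complex.arg (t i), funext fun i => Circle.exp_arg (t i)⟩

/-- Point evaluations are continuous on `C^p(γ)`. -/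
theorem continuous_toFun : Continuous (CpSpace.toFun : CpSpace p γ → torusImage γ → ℂ) := by
  refine continuous_pi ?_
  rintro ⟨_, t, rfl⟩
  obtain ⟨θ, rfl⟩ := torusExp_surjective t
  let L : CpSpace p γ →ₗ[ℂ] ℂ :=
    { toFun := fun f => f.toFun ⟨prodCurve γ (torusExp θ), mem_range_self _⟩
      map_add' := fun _ _ => rfl
      map_smul' := fun _ _ => rfl }
  -- The order-zero seminorm, i.e. the sup norm, is available for every `p` and bounds evaluations.
  let ι : Σ k : {k : ℕ // (k : ℕ∞) ≤ p}, Fin k.1 → Fin n := ⟨⟨0, by simp⟩, Fin.elim0⟩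
  have hb : Seminorm.IsBounded (cpSeminorm p γ) (fun _ : Fin 1 => normSeminorm ℂ ℂ) L := by
    refine Seminorm.isBounded_const (Fin 1) L |>.2 ⟨{ι}, 1, fun f => ?_⟩
    have h1 : ‖torusPartial (pullback γ f.toFun) 0 Fin.elim0 θ‖ ≤ cpSeminorm p γ ι f :=
      le_ciSup (bddAbove_torusPartial (p := p) f.isCpTorus (by simp) Fin.elim0) θ
    have h2 : ‖L f‖ ≤ cpSeminorm p γ ι f := by
      change ‖f.toFun ⟨prodCurve γ (torusExp θ), mem_range_self _⟩‖ ≤ _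
      simpa [torusPartial, pullback] using h1
    simpa using h2
  exact WithSeminorms.continuous_of_isBounded withSeminorms_cpSeminorm (norm_withSeminorms ℂ ℂ) L hb

/-- Complements of countably many linear subspaces missing a common vector are dense. -/
theorem dense_setOf_forall_notMem {V ι : Type*} [AddCommGroup V] [Module ℂ V] [TopologicalSpace V]
    [ContinuousAdd V] [ContinuousSMul ℂ V] [Countable ι] (S : ι → Submodule ℂ V) {g : V}
    (hg : ∀ i, g ∉ S i) : Dense {f : V | ∀ i, f ∉ S i} := by
  intro f
  -- Two parameters putting the line in the same `S i` would, by subtraction, put `g` in `S i`.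
  have hcount : {ε : ℝ | ∃ i, f + (ε : ℂ) • g ∈ S i}.Countable := by
    rw [show {ε : ℝ | ∃ i, f + (ε : ℂ) • g ∈ S i} = ⋃ i, {ε : ℝ | f + (ε : ℂ) • g ∈ S i} by
      ext; simp]
    refine countable_iUnion fun i => Set.Subsingleton.countable fun a ha b hb => ?_
    by_contra hab
    have h1 : (((a - b : ℝ) : ℂ)) • g ∈ S i := by
      have := (S i).sub_mem ha hb
      rwa [add_sub_add_left_eq_sub, ← sub_smul, ← Complex.ofReal_sub] at this
    have hne : ((a - b : ℝ) : ℂ) ≠ 0 := by exact_mod_cast sub_ne_zero.2 hab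
    exact hg i (((S i).smul_mem_iff hne).1 h1)
  have hd := hcount.dense_compl ℝ (0 : ℝ)
  have hcont : Continuous fun ε : ℝ => f + (ε : ℂ) • g := by fun_prop
  have := hcont.continuousAt.continuousWithinAt.mem_closure_image hd
  simp only [Complex.ofReal_zero, zero_smul, add_zero] at this
  refine closure_mono ?_ this
  rintro _ ⟨ε, hε, rfl⟩ i hi
  exact hε ⟨i, hi⟩

end CpSpaceTopology

/-! ### Holomorphic extendability in `C^p(γ)` -/

section Holomorphic

variable {n : ℕ} {p : ℕ∞} {γ : Fin n → Circle → ℂ}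

theorem isHolExtendableAt_iff {L : Set (Fin n → ℂ)} {f : L → ℂ} {ζ : Fin n → ℂ} :
    IsHolExtendableAt f ζ ↔
      ∃ m : ℕ, f ∈ holomorphicClass (Subtype.val : L → Fin n → ℂ) ζ (1 / (m + 1)) m := by
  constructor
  · rintro ⟨U, F, hU, hζ, hF, hf⟩
    exact exists_mem_holomorphicClass hU hζ hF hf
  · rintro ⟨m, F, hF, -, hf⟩
    exact ⟨ball ζ (1 / (m + 1)), F, isOpen_ball, mem_ball_self (by positivity), hF, hf⟩

theorem isGδ_setOf_not_isHolExtendableAt (ζ : Fin n → ℂ) :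
    IsGδ {f : CpSpace p γ | ¬ IsHolExtendableAt f.toFun ζ} := by
  simp only [isHolExtendableAt_iff, not_exists, ofPred_forall]
  exact IsGδ.iInter fun m =>
    ((isClosed_holomorphicClass _ _ _ _).preimage continuous_toFun).isOpen_compl.isGδ

/-- The elements of `C^p(γ)` which are holomorphically extendable at `ζ`. -/
def holExtendableSubmodule (p : ℕ∞) (γ : Fin n → Circle → ℂ) (ζ : Fin n → ℂ) :
    Submodule ℂ (CpSpace p γ) where
  carrier := {f | IsHolExtendableAt f.toFun ζ}
  add_mem' := by
    rintro f g ⟨U, F, hU, hζU, hF, hf⟩ ⟨V, G, hV, hζV, hG, hg⟩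
    refine ⟨U ∩ V, F + G, hU.inter hV, ⟨hζU, hζV⟩,
      (hF.mono inter_subset_left).add (hG.mono inter_subset_right), fun z hz => ?_⟩
    exact congrArg₂ (· + ·) (hf z hz.1) (hg z hz.2)
  zero_mem' := ⟨univ, 0, isOpen_univ, mem_univ _, differentiableOn_const 0, fun _ _ => rfl⟩
  smul_mem' := by
    rintro a f ⟨U, F, hU, hζU, hF, hf⟩
    exact ⟨U, a • F, hU, hζU, hF.const_smul a, fun z hz => congrArg (a • ·) (hf z hz)⟩

/-- Nowhere extendability can be tested on a dense sequence of points. -/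
theorem exists_seq_forall_isHolExtendableAt_iff (L : Set (Fin n → ℂ)) (hL : L.Nonempty) :
    ∃ d : ℕ → L, ∀ f : L → ℂ, (∀ ζ ∈ L, ¬ IsHolExtendableAt f ζ) ↔
      ∀ i, ¬ IsHolExtendableAt f (d i) := by
  have : Nonempty L := hL.to_subtype
  refine ⟨TopologicalSpace.denseSeq L, fun f => ⟨fun h i => h _ (Subtype.property _), ?_⟩⟩
  rintro h ζ hζ ⟨U, F, hU, hζU, hF, hf⟩
  obtain ⟨i, hi⟩ := (TopologicalSpace.denseRange_denseSeq L).exists_mem_open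
    (hU.preimage continuous_subtype_val) ⟨⟨ζ, hζ⟩, hζU⟩
  exact h i ⟨U, F, hU, hi, hF, hf⟩

/-- If `h ∘ γ_i` is `C^p`, then `z ↦ h (z_i)` belongs to `C^p(γ)`. -/
def CpSpace.ofCoord (i : Fin n) (h : ℂ → ℂ) (hh : IsCpCurve p fun t => h (γ i t)) : CpSpace p γ :=
  ⟨fun z => h (z.1 i), by
    have h1 : ContDiff ℝ p fun θ : ℝ => h (γ i (Circle.exp θ)) := hh
    exact h1.comp (contDiff_apply ℝ ℝ i)⟩

/-- Take a nowhere extendable function of the coordinate `z i`. An extension in several variables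
restricts to the complex line through the point in direction `i`, giving a forbidden one-variable
extension. -/
theorem exists_cpSpace_nowhere_isHolExtendableAt (i : Fin n)
    (hγ : IsCpCurve p (γ i)) (hinj : IsLocallyInjectiveCurve (γ i)) :
    ∃ g : CpSpace p γ, ∀ ζ ∈ torusImage γ, ¬ IsHolExtendableAt g.toFun ζ := by
  obtain ⟨h, hh, hne⟩ := exists_nowhere_extendable hγ hinj
  refine ⟨CpSpace.ofCoord i h hh, ?_⟩
  rintro _ ⟨t, rfl⟩ ⟨U, F, hU, htU, hF, hf⟩
  let ℓ : ℂ → Fin n → ℂ := fun z => Function.update (prodCurve γ t) i z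
  have hℓ : Differentiable ℂ ℓ := differentiable_pi.2 fun k => by
    by_cases hk : k = i
    · subst hk
      simp [ℓ]
    · simp [ℓ, Function.update_of_ne hk]
  have hℓc (s : Circle) : ℓ (γ i s) = prodCurve γ (Function.update t i s) := by
    ext k
    by_cases hk : k = i
    · subst hk
      simp [ℓ, prodCurve]
    · simp [ℓ, prodCurve, Function.update_of_ne hk]
  refine hne (t i) (ℓ ⁻¹' U) (F ∘ ℓ) (hU.preimage hℓ.continuous) ?_
    (hF.comp hℓ.differentiableOn fun z hz => hz) fun s hs => ?_
  · rw [mem_preimage, hℓc, Function.update_eq_self]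
    exact htU
  · have h1 := hf ⟨ℓ (γ i s), hℓc s ▸ mem_range_self _⟩ hs
    refine h1.trans ?_
    change h (ℓ (γ i s) i) = h (γ i s)
    simp [ℓ]

end Holomorphic

/-! ### Real analyticity in `C^p(γ)` -/

section RealAnalytic

variable {n : ℕ} {p : ℕ∞} {γ : Fin n → Circle → ℂ}

/-- The choice of angles is immaterial, since two lifts of a torus point differ by a period of
`torusExp`. -/
theorem isRealAnalyticAt_torusExp_iff {g : (Fin n → Circle) → ℂ} {θ : Fin n → ℝ} :
    IsRealAnalyticAt g (torusExp θ) ↔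
      AnalyticAt ℝ (fun s : Fin n → ℝ => g (torusExp s)) θ := by
  refine ⟨?_, fun h => ⟨θ, rfl, h⟩⟩
  rintro ⟨θ', hθ', h⟩
  have hper : ∀ s : Fin n → ℝ, torusExp (s + (θ' - θ)) = torusExp s := by
    intro s
    ext1 i
    have hi : Circle.exp (θ' i) = Circle.exp (θ i) := congrFun hθ' i
    simp [torusExp, Circle.exp_add, Circle.exp_sub, hi]
  have h1 : AnalyticAt ℝ (fun s : Fin n → ℝ => g (torusExp (s + (θ' - θ)))) θ :=
    AnalyticAt.fun_comp (f := fun s : Fin n → ℝ => s + (θ' - θ)) 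
      (x := θ) (by rw [add_sub_cancel]; exact h) (analyticAt_id.add analyticAt_const)
  simpa only [hper] using h1

theorem isGδ_setOf_not_isRealAnalyticAt (t : Fin n → Circle) :
    IsGδ {f : CpSpace p γ | ¬ IsRealAnalyticAt (pullback γ f.toFun) t} := by
  obtain ⟨θ, rfl⟩ := torusExp_surjective t
  simp only [isRealAnalyticAt_torusExp_iff, analyticAt_iff_exists_mem_powerSeriesClass,
    not_exists, ofPred_forall]
  refine IsGδ.iInter fun m => ?_
  have hcl := isClosed_powerSeriesClass θ (C := m + 1) (r := 1 / (2 * (m + 1)))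
    (by positivity) (by positivity) (by
      rw [show ((m : ℝ) + 1) * (1 / (2 * (m + 1))) = 1 / 2 by field_simp]
      norm_num)
  have hc : Continuous fun (f : CpSpace p γ) (s : Fin n → ℝ) => pullback γ f.toFun (torusExp s) :=
    continuous_pi fun s => (continuous_apply _).comp continuous_toFun
  exact (hcl.preimage hc).isOpen_compl.isGδ

/-- The elements of `C^p(γ)` which are real analytic at `γ(t)`. -/
def realAnalyticSubmodule (p : ℕ∞) (γ : Fin n → Circle → ℂ) (θ : Fin n → ℝ) :
    Submodule ℂ (CpSpace p γ) where
  carrier := {f | AnalyticAt ℝ (fun s : Fin n → ℝ => pullback γ f.toFun (torusExp s)) θ}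
  add_mem' hf hg := AnalyticAt.add hf hg
  zero_mem' := analyticAt_const (v := (0 : ℂ))
  smul_mem' a _ hf := AnalyticAt.const_smul (c := a) hf

/-- Nowhere analyticity can be tested on a dense sequence of points. -/
theorem forall_not_isRealAnalyticAt_iff (g : (Fin n → Circle) → ℂ) :
    (∀ t, ¬ IsRealAnalyticAt g t) ↔
      ∀ i, ¬ IsRealAnalyticAt g (torusExp (TopologicalSpace.denseSeq (Fin n → ℝ) i)) := by
  refine ⟨fun h i => h _, fun h t ht => ?_⟩
  obtain ⟨θ, rfl⟩ := torusExp_surjective t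
  rw [isRealAnalyticAt_torusExp_iff] at ht
  obtain ⟨i, hi⟩ := (TopologicalSpace.denseRange_denseSeq (Fin n → ℝ)).exists_mem_open
    (isOpen_analyticAt ℝ _) ⟨θ, ht⟩
  exact h i (isRealAnalyticAt_torusExp_iff.2 hi)

theorem exists_cpSpace_nowhere_isRealAnalyticAt (i : Fin n)
    (hinj : Function.Injective (γ i)) :
    ∃ g : CpSpace p γ, ∀ t, ¬ IsRealAnalyticAt (pullback γ g.toFun) t := by
  obtain ⟨h, hh, hne⟩ := exists_nowhere_analytic p
  have hinv : ∀ t, h (Function.invFun (γ i) (γ i t)) = h t := fun t => by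
    rw [Function.leftInverse_invFun hinj t]
  -- Smoothness and analyticity are tested on the pullback, where `invFun` cancels `γ i`; no
  -- regularity of the inverse enters.
  refine ⟨CpSpace.ofCoord i (fun z => h (Function.invFun (γ i) z)) (by simpa only [hinv] using hh),
    fun t ht => ?_⟩
  obtain ⟨θ, rfl⟩ := torusExp_surjective t
  rw [isRealAnalyticAt_torusExp_iff] at ht
  refine hne (θ i) ?_
  have hline : AnalyticAt ℝ (fun s : ℝ => Function.update θ i s) (θ i) := by
    refine AnalyticAt.pi fun k => ?_
    by_cases hk : k = i
    · subst hk
      simp only [Function.update_self]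
      exact analyticAt_id
    · simpa [Function.update_of_ne hk] using analyticAt_const
  have h1 := AnalyticAt.fun_comp (f := fun s : ℝ => Function.update θ i s) (x := θ i)
    (by rw [Function.update_eq_self]; exact ht) hline
  have h2 (s : ℝ) : pullback γ (CpSpace.ofCoord (p := p) i (fun z => h (Function.invFun (γ i) z))
      (by simpa only [hinv] using hh)).toFun (torusExp (Function.update θ i s)) =
      h (Circle.exp s) := by
    change h (Function.invFun (γ i) (γ i (Circle.exp (Function.update θ i s i)))) = _
    rw [hinv, Function.update_self]
  simpa only [h2] using h1

theorem IsAnalyticJordanCurve.injective {c : Circle → ℂ} (hc : IsAnalyticJordanCurve c) :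
    Function.Injective c := by
  obtain ⟨V, Φ, -, hV, -, hinj, hcΦ⟩ := hc
  intro s t hst
  rw [hcΦ, hcΦ] at hst
  exact Subtype.ext (hinj (hV s) (hV t) hst)

end RealAnalytic

end HolExt

theorem mainTheorem9 {n : ℕ} (hn : 1 ≤ n) (p : ℕ∞) (γ : Fin n → Circle → ℂ) :
    ((∀ i, HolExt.IsCpCurve p (γ i) ∧ HolExt.IsLocallyInjectiveCurve (γ i)) →
      (∀ ζ ∈ HolExt.torusImage γ,
        IsGδ {f : HolExt.CpSpace p γ | ¬ HolExt.IsHolExtendableAt f.toFun ζ} ∧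
        Dense {f : HolExt.CpSpace p γ | ¬ HolExt.IsHolExtendableAt f.toFun ζ}) ∧
      IsGδ {f : HolExt.CpSpace p γ |
        ∀ ζ ∈ HolExt.torusImage γ, ¬ HolExt.IsHolExtendableAt f.toFun ζ} ∧
      Dense {f : HolExt.CpSpace p γ |
        ∀ ζ ∈ HolExt.torusImage γ, ¬ HolExt.IsHolExtendableAt f.toFun ζ}) ∧
    ((∀ i, HolExt.IsAnalyticJordanCurve (γ i)) →
      (∀ t : Fin n → Circle,
        IsGδ {f : HolExt.CpSpace p γ |
          ¬ HolExt.IsRealAnalyticAt (HolExt.pullback γ f.toFun) t} ∧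
        Dense {f : HolExt.CpSpace p γ |
          ¬ HolExt.IsRealAnalyticAt (HolExt.pullback γ f.toFun) t}) ∧
      IsGδ {f : HolExt.CpSpace p γ |
        ∀ t : Fin n → Circle, ¬ HolExt.IsRealAnalyticAt (HolExt.pullback γ f.toFun) t} ∧
      Dense {f : HolExt.CpSpace p γ |
        ∀ t : Fin n → Circle, ¬ HolExt.IsRealAnalyticAt (HolExt.pullback γ f.toFun) t}) := by
  let i₀ : Fin n := ⟨0, hn⟩
  constructor
  · intro hγ
    obtain ⟨g, hg⟩ := HolExt.exists_cpSpace_nowhere_isHolExtendableAt i₀ (hγ i₀).1 (hγ i₀).2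
    obtain ⟨d, hd⟩ := HolExt.exists_seq_forall_isHolExtendableAt_iff (HolExt.torusImage γ)
      (range_nonempty _)
    have hdense : Dense {f : HolExt.CpSpace p γ |
        ∀ ζ ∈ HolExt.torusImage γ, ¬ HolExt.IsHolExtendableAt f.toFun ζ} := by
      simp only [hd]
      exact HolExt.dense_setOf_forall_notMem
        (fun i => HolExt.holExtendableSubmodule p γ (d i)) fun i => hg _ (d i).2
    refine ⟨fun ζ hζ => ⟨HolExt.isGδ_setOf_not_isHolExtendableAt ζ,
      hdense.mono fun _ hf => by exact hf ζ hζ⟩, ?_, hdense⟩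
    simp only [hd, ofPred_forall]
    exact IsGδ.iInter fun i => HolExt.isGδ_setOf_not_isHolExtendableAt _
  · intro hγ
    obtain ⟨g, hg⟩ := HolExt.exists_cpSpace_nowhere_isRealAnalyticAt (p := p) (γ := γ) i₀
      (hγ i₀).injective
    have hdense : Dense {f : HolExt.CpSpace p γ |
        ∀ t : Fin n → Circle, ¬ HolExt.IsRealAnalyticAt (HolExt.pullback γ f.toFun) t} := by
      simp only [HolExt.forall_not_isRealAnalyticAt_iff, HolExt.isRealAnalyticAt_torusExp_iff]
      exact HolExt.dense_setOf_forall_notMem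
        (fun i => HolExt.realAnalyticSubmodule p γ (TopologicalSpace.denseSeq (Fin n → ℝ) i))
        fun i hi => hg _ (HolExt.isRealAnalyticAt_torusExp_iff.2 hi)
    refine ⟨fun t => ⟨HolExt.isGδ_setOf_not_isRealAnalyticAt t,
      hdense.mono fun _ hf => by exact hf t⟩, ?_, hdense⟩
    simp only [HolExt.forall_not_isRealAnalyticAt_iff, ofPred_forall]
    exact IsGδ.iInter fun i => HolExt.isGδ_setOf_not_isRealAnalyticAt _
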